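/- A \emph{compact pospace} is a compact topological space $X$ with a partial order that is closed in $X\times X$ (so $X$ is Hausdorff); let $\mathsf{PC}$ be the category of compact pospaces and continuous monotone maps. A signature is a set of function symbols, each with a set as its arity; it is \emph{finitary} if all arities are finite, and \emph{$\kappa$-ary} if all arities have cardinality $<\kappa$. A class of algebras of a fixed signature is regarded as a category with all homomorphisms between its members; it is an \emph{$\mathrm{SP}$-class} if it is closed under (non-empty) subalgebras and arbitrary Cartesian products. A \emph{variety} is the class of all algebras of a signature that satisfy some class of equations; a \emph{$\kappa$-ary quasi-variety} is the class of all algebras of a $\kappa$-ary signature that satisfy some class of implications $\left(\bigwedge_{i\in I} s_i=t_i\right)\Rightarrow s=t$ with $|I|<\kappa$; finitary means $\kappa=\aleph_0$. \textbf{Corollary.} The category $\mathsf{PC}^{\mathrm{op}}$ is not equivalent to any $\mathrm{SP}$-class of finitary algebras. In particular, it is not equivalent to any finitary variety or to any finitary quasi-variety. Hence $\aleph_1$ is the best possible bound on arities: if $\mathsf{PC}^{\mathrm{op}}$ is equivalent to a variety of $\kappa$-ary algebras or to a $\kappa$-ary quasi-variety, then $\kappa\ge\aleph_1$. -/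

import Mathlib

open CategoryTheory Cardinal

universe u

/-! ### Compact pospaces -/

/-- A compact ordered space (compact pospace): a compact space with a partial order that is closed
in the product topology. Such a space is automatically Hausdorff; it may be empty. -/
structure CompactPospace : Type (u + 1) where
  carrier : Type u
  [top : TopologicalSpace carrier]
  [compact : CompactSpace carrier]
  [order : PartialOrder carrier]
  [closed : OrderClosedTopology carrier]

namespace CompactPospace

instance : CoeSort CompactPospace.{u} (Type u) := ⟨CompactPospace.carrier⟩

instance (X : CompactPospace.{u}) : TopologicalSpace X := X.top
instance (X : CompactPospace.{u}) : CompactSpace X := X.compact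
instance (X : CompactPospace.{u}) : PartialOrder X := X.order
instance (X : CompactPospace.{u}) : OrderClosedTopology X := X.closed

/-- The category of compact pospaces and continuous monotone maps. -/
instance : Category.{u} CompactPospace.{u} where
  Hom X Y := X →Co Y
  id X := ContinuousOrderHom.id X
  comp f g := ContinuousOrderHom.comp g f

end CompactPospace

/-! ### Signatures, algebras and homomorphisms -/

/-- A single-sorted algebraic signature: a set of function symbols, each with a set as its arity. -/
structure Signature : Type (u + 1) where
  Op : Type u
  arity : Op → Type u

namespace Signature

/-- All function symbols have finite arity. -/
def IsFinitary (S : Signature.{u}) : Prop := ∀ o, Finite (S.arity o)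

/-- All function symbols have arity smaller than `κ`. -/
def IsAry (S : Signature.{u}) (κ : Cardinal.{u}) : Prop := ∀ o, #(S.arity o) < κ

/-- An algebra for the signature `S`. The carrier may be empty if `S` has no constants. -/
structure Alg (S : Signature.{u}) : Type (u + 1) where
  carrier : Type u
  op : ∀ o : S.Op, (S.arity o → carrier) → carrier

namespace Alg

variable {S : Signature.{u}}

instance : CoeSort S.Alg (Type u) := ⟨Alg.carrier⟩

/-- Homomorphisms of algebras. -/
@[ext]
structure Hom (A B : S.Alg) : Type u where
  toFun : A → B
  map_op : ∀ (o : S.Op) (x : S.arity o → A), toFun (A.op o x) = B.op o (fun i => toFun (x i))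

/-- The category of all `S`-algebras and homomorphisms. -/
instance : Category.{u} S.Alg where
  Hom A B := Hom A B
  id A := ⟨fun a => a, fun _ _ => rfl⟩
  comp f g := ⟨fun a => g.toFun (f.toFun a), fun o x => by rw [f.map_op, g.map_op]⟩

/-- A subset closed under all operations. -/
def IsSubuniverse (A : S.Alg) (T : Set A) : Prop :=
  ∀ (o : S.Op) (x : S.arity o → A), (∀ i, x i ∈ T) → A.op o x ∈ T

/-- The subalgebra carried by a subset closed under all operations. -/
def sub (A : S.Alg) (T : Set A) (hT : A.IsSubuniverse T) : S.Alg where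
  carrier := T
  op o x := ⟨A.op o (fun i => (x i).1), hT o _ (fun i => (x i).2)⟩

/-- The Cartesian product of a (possibly empty) family of algebras, with pointwise operations. -/
def prod {I : Type u} (A : I → S.Alg) : S.Alg where
  carrier := ∀ i, A i
  op o x := fun i => (A i).op o (fun j => x j i)

end Alg

variable {S : Signature.{u}}

/-- A class of algebras closed under subalgebras and Cartesian products. Only non-empty subalgebras
are required to belong to the class, so that the definition covers both usual conventions
(the empty algebra is admitted, or it is not). -/
structure IsSPClass (K : ObjectProperty S.Alg) : Prop where
  sub_mem : ∀ (A : S.Alg) (T : Set A) (hT : A.IsSubuniverse T), K A → T.Nonempty → K (A.sub T hT)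
  prod_mem : ∀ {I : Type u} (A : I → S.Alg), (∀ i, K (A i)) → K (Alg.prod A)

/-! ### Varieties and quasi-varieties -/

/-- Terms in the variables `V`. -/
inductive Term (S : Signature.{u}) (V : Type u) : Type u
  | var : V → Term S V
  | app : (o : S.Op) → (S.arity o → Term S V) → Term S V

/-- The value of a term in an algebra under a valuation of the variables. -/
def Term.eval {V : Type u} (A : S.Alg) (v : V → A) : Term S V → A
  | .var a => v a
  | .app o t => A.op o (fun i => (t i).eval A v)

/-- An equation `lhs = rhs` between terms in a set of variables. -/
structure Equation (S : Signature.{u}) : Type (u + 1) where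
  Var : Type u
  lhs : Term S Var
  rhs : Term S Var

/-- The equation holds in `A` under every valuation. -/
def Equation.Holds (e : Equation S) (A : S.Alg) : Prop :=
  ∀ v : e.Var → A, e.lhs.eval A v = e.rhs.eval A v

/-- An implication: if `premLhs i = premRhs i` for all `i` in a set, then `lhs = rhs`. -/
structure Implication (S : Signature.{u}) : Type (u + 1) where
  Var : Type u
  Prem : Type u
  premLhs : Prem → Term S Var
  premRhs : Prem → Term S Var
  lhs : Term S Var
  rhs : Term S Var

/-- The implication holds in `A` under every valuation. -/
def Implication.Holds (e : Implication S) (A : S.Alg) : Prop :=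
  ∀ v : e.Var → A, (∀ i, (e.premLhs i).eval A v = (e.premRhs i).eval A v) →
    e.lhs.eval A v = e.rhs.eval A v

/-- A variety: the class of all algebras satisfying some class of equations. -/
def IsVariety (K : ObjectProperty S.Alg) : Prop :=
  ∃ E : Set (Equation S), ∀ A, K A ↔ ∀ e ∈ E, e.Holds A

/-- The class of all algebras satisfying some class of implications, each of which has fewer
than `κ` premises. -/
def IsQuasiVariety (κ : Cardinal.{u}) (K : ObjectProperty S.Alg) : Prop :=
  ∃ E : Set (Implication S), (∀ e ∈ E, #e.Prem < κ) ∧ ∀ A, K A ↔ ∀ e ∈ E, e.Holds A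

end Signature

/-- The opposite of the category of compact pospaces is equivalent to the category whose objects
are the algebras in `K` and whose morphisms are all homomorphisms between them. -/
def PospaceOpEquivTo {S : Signature.{u}} (K : ObjectProperty S.Alg) : Prop :=
  Nonempty (CompactPospace.{u}ᵒᵖ ≌ K.FullSubcategory)

/-!
Suppose that `PC^op` is equivalent to an `SP`-class `K` of finitary algebras. An `SP`-class has a
free algebra on one generator (`Signature.IsSPClass.exists_isFreeOn`); let `L` be the compact
pospace that corresponds to it. The elements of the algebra corresponding to a compact pospace `X`
are then the continuous monotone maps `X → L`, naturally in `X`. This has two consequences.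

* Distinct points of a compact pospace are separated by a continuous monotone map to `L`, because
  the equivalence is faithful and homomorphisms are determined by their values.
* The power `L ^ V` corresponds to the coproduct of `V` copies of the free algebra, which is
  generated by the elements corresponding to the coordinate projections, since the subalgebra
  they generate is in `K` and is a retract. So every continuous monotone map `L ^ V → L` is the
  value of a term at the projections. As a term of a finitary signature mentions only finitely many
  variables, such a map depends on only finitely many coordinates.

These are contradictory. By the first, there is a non-constant continuous monotone map from the
unit interval to `L`; after reparametrization it becomes `h : ℝ → L` with `h t ≠ h 0` for `t > 0`.
In particular `L` has elements `a < b`. Nachbin's monotone version of Urysohn's lemma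
(`exists_monotone_continuous_separating`) gives a continuous monotone `g : L → [0, 1]` with
`g a = 0` and `g b = 1`. The map `x ↦ h (∑ n, g (x n) / 2 ^ n)` from `L ^ ℕ` to `L` depends on
every coordinate, contrary to the second.

Varieties and quasi-varieties are `SP`-classes, and a cardinal below `ℵ₁` is at most `ℵ₀`, so the
remaining assertions follow.
-/

open Opposite Set

/-! ### A monotone Urysohn lemma -/

/-- Between a closed set and an open lower set containing it, there is an open lower set whose
closure is still contained in the larger one. -/
theorem exists_isOpen_isLowerSet_between {X : Type*} [TopologicalSpace X] [CompactSpace X]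
    [PartialOrder X] [OrderClosedTopology X] {c u : Set X} (hc : IsClosed c) (hu : IsOpen u)
    (hul : IsLowerSet u) (hcu : c ⊆ u) :
    ∃ v, IsOpen v ∧ c ⊆ v ∧ closure v ⊆ u ∧ IsLowerSet v := by
  have hdown : IsClosed {y : X | ∃ x ∈ c, y ≤ x} := by
    have : IsCompact {p : X × X | p.2 ∈ c ∧ p.1 ≤ p.2} :=
      ((hc.preimage continuous_snd).inter
        (isClosed_le continuous_fst continuous_snd)).isCompact
    convert (this.image continuous_fst).isClosed using 1
    ext y
    simp
  obtain ⟨w, hw, hcw, hwu⟩ := normal_exists_closure_subset hdown hu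
    (by rintro y ⟨x, hx, hyx⟩; exact hul hyx (hcu hx))
  have hup : IsClosed {y : X | ∃ x ∈ wᶜ, x ≤ y} := by
    have : IsCompact {p : X × X | p.1 ∈ wᶜ ∧ p.1 ≤ p.2} :=
      ((hw.isClosed_compl.preimage continuous_fst).inter
        (isClosed_le continuous_fst continuous_snd)).isCompact
    convert (this.image continuous_snd).isClosed using 1
    ext y
    simp
  -- The largest lower set contained in `w` is open and contains the lower closure of `c`.
  have hvw : {y : X | ∃ x ∈ wᶜ, x ≤ y}ᶜ ⊆ w := fun y hy => by
    by_contra h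
    exact hy ⟨y, h, le_rfl⟩
  refine ⟨_, hup.isOpen_compl, ?_, (closure_mono hvw).trans hwu, ?_⟩
  · rintro y hy ⟨x, hx, hxy⟩
    exact hx (hcw ⟨y, hy, hxy⟩)
  · rintro y z hzy hy ⟨x, hx, hxz⟩
    exact hy ⟨x, hx, hxz.trans hzy⟩

/-- The approximations in the proof of Urysohn's lemma are monotone if the open sets used are lower
sets. -/
theorem Urysohns.CU.monotone_approx {X : Type*} [TopologicalSpace X] [Preorder X]
    (n : ℕ) (c : Urysohns.CU fun _ u : Set X => IsLowerSet u) : Monotone (c.approx n) := by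
  induction n generalizing c with
  | zero =>
    intro x y hxy
    simp only [approx, indicator, mem_compl_iff, Pi.one_apply]
    have hl : y ∈ c.U → x ∈ c.U := fun hy => c.P_C_U hxy hy
    by_cases hx : x ∈ c.U <;> by_cases hy : y ∈ c.U <;> simp_all
  | succ n ih =>
    intro x y hxy
    exact midpoint_le_midpoint (ih _ hxy) (ih _ hxy)

/-- Nachbin's lemma: in a compact pospace, points `a`, `b` with `b ≰ a` are separated by a continuous
monotone function to the unit interval. Urysohn's construction is started from the closed lower set
`Iic a` inside the open lower set `(Ici b)ᶜ`. -/
theorem exists_monotone_continuous_separating {X : Type*} [TopologicalSpace X] [CompactSpace X]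
    [PartialOrder X] [OrderClosedTopology X] {a b : X} (hab : ¬ b ≤ a) :
    ∃ g : X → ℝ, Continuous g ∧ Monotone g ∧ g a = 0 ∧ g b = 1 ∧ ∀ x, g x ∈ Icc (0 : ℝ) 1 := by
  let c : Urysohns.CU fun _ u : Set X => IsLowerSet u :=
    { C := Iic a
      U := (Ici b)ᶜ
      P_C_U := (isUpperSet_Ici b).compl
      closed_C := isClosed_Iic
      open_U := isClosed_Ici.isOpen_compl
      subset := fun x hx hbx => hab (le_trans hbx hx)
      hP := fun hc hul hu hcu => by
        obtain ⟨v, hv, hcv, hvu, hvl⟩ := exists_isOpen_isLowerSet_between hc hu hul hcu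
        exact ⟨v, hv, hcv, hvu, hvl, hul⟩ }
  refine ⟨c.lim, c.continuous_lim, fun x y hxy => ?_, c.lim_of_mem_C a le_rfl,
    c.lim_of_notMem_U b fun h => h le_rfl, c.lim_mem_Icc⟩
  exact ciSup_mono (c.bddAbove_range_approx y) fun n => c.monotone_approx n hxy

/-! ### Terms, subalgebras and products -/

namespace Signature

variable {S : Signature.{u}} {V : Type u}

theorem Alg.Hom.map_eval {A B : S.Alg} (f : Alg.Hom A B) (v : V → A) (t : Term S V) :
    f.toFun (t.eval A v) = t.eval B (fun i => f.toFun (v i)) := by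
  induction t with
  | var => rfl
  | app o t ih =>
    rw [Term.eval, f.map_op]
    exact congrArg _ (funext ih)

/-- The inclusion of a subalgebra. -/
def Alg.subtype (A : S.Alg) (T : Set A) (hT : A.IsSubuniverse T) : Alg.Hom (A.sub T hT) A :=
  ⟨Subtype.val, fun _ _ => rfl⟩

/-- The projection of a product of algebras to a factor. -/
def Alg.proj {I : Type u} (A : I → S.Alg) (i : I) : Alg.Hom (Alg.prod A) (A i) :=
  ⟨fun a => a i, fun _ _ => rfl⟩

theorem Alg.isSubuniverse_range_eval (A : S.Alg) (v : V → A) :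
    A.IsSubuniverse (range fun t : Term S V => t.eval A v) := by
  intro o x hx
  choose t ht using hx
  refine ⟨.app o t, congrArg _ (funext ht)⟩

/-- The subalgebra generated by a family of elements. -/
def Alg.generated (A : S.Alg) (v : V → A) : S.Alg :=
  A.sub (range fun t : Term S V => t.eval A v) (A.isSubuniverse_range_eval v)

/-- A member of the generating family, as an element of the generated subalgebra. -/
def Alg.gen (A : S.Alg) (v : V → A) (i : V) : A.generated v :=
  ⟨v i, .var i, rfl⟩

theorem IsSPClass.generated_mem {K : ObjectProperty S.Alg} (hK : IsSPClass K) {A : S.Alg}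
    (hA : K A) [Nonempty V] (v : V → A) : K (A.generated v) :=
  hK.sub_mem A _ _ hA ⟨_, .var (Classical.arbitrary V), rfl⟩

/-- A term of a finitary signature mentions only finitely many variables. -/
theorem Term.exists_finite_dependsOn (hS : S.IsFinitary) (t : Term S V) :
    ∃ s : Set V, s.Finite ∧ ∀ A : S.Alg, DependsOn (fun v : V → A => t.eval A v) s := by
  induction t with
  | var i => exact ⟨{i}, finite_singleton i, fun A v w h => h i rfl⟩
  | app o t ih =>
    choose s hs hd using ih
    have := hS o
    refine ⟨⋃ i, s i, finite_iUnion hs, fun A v w h => congrArg (A.op o) (funext fun i => ?_)⟩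
    exact hd i A fun j hj => h j (mem_iUnion_of_mem i hj)

theorem IsQuasiVariety.isSPClass {κ : Cardinal.{u}} {K : ObjectProperty S.Alg}
    (hK : IsQuasiVariety κ K) : IsSPClass K := by
  obtain ⟨E, -, hE⟩ := hK
  constructor
  · intro A T hT hA _
    refine (hE _).2 fun e he v hv => Subtype.val_injective ?_
    have key := (A.subtype T hT).map_eval (V := e.Var) v
    refine (key _).trans (((hE _).1 hA e he _ fun i => ?_).trans (key _).symm)
    rw [← key, ← key, hv]
  · intro I A hA
    refine (hE _).2 fun e he v hv => funext fun i => ?_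
    have key := (Alg.proj A i).map_eval (V := e.Var) v
    refine (key _).trans (((hE _).1 (hA i) e he _ fun j => ?_).trans (key _).symm)
    rw [← key, ← key, hv]

/-- Equations are implications without premises. -/
theorem IsVariety.isQuasiVariety {K : ObjectProperty S.Alg} (hK : IsVariety K) :
    IsQuasiVariety ℵ₀ K := by
  obtain ⟨E, hE⟩ := hK
  let toImp (e : Equation S) : Implication S :=
    ⟨e.Var, PEmpty, PEmpty.elim, PEmpty.elim, e.lhs, e.rhs⟩
  refine ⟨toImp '' E, ?_, fun A => (hE A).trans ?_⟩
  · rintro _ ⟨e, -, rfl⟩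
    exact Cardinal.lt_aleph0_of_finite PEmpty
  · rw [forall_mem_image]
    exact forall₂_congr fun e _ => ⟨fun h v _ => h v, fun h v => h v fun i => i.elim⟩

/-! ### Free algebras -/

/-- `A` is free on the single generator `g` with respect to the class `K`: each element of an
algebra in `K` is the image of `g` under exactly one homomorphism. -/
def IsFreeOn (K : ObjectProperty S.Alg) (A : S.Alg) (g : A) : Prop :=
  ∀ B, K B → ∀ b : B, ∃! f : Alg.Hom A B, f.toFun g = b

/-- Homomorphisms out of a generated subalgebra are determined by the generators. -/
theorem Alg.generated_hom_ext {A B : S.Alg} {v : V → A} {f f' : Alg.Hom (A.generated v) B}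
    (h : ∀ i, f.toFun (A.gen v i) = f'.toFun (A.gen v i)) : f = f' := by
  have key (t : Term S V) : t.eval (A.generated v) (A.gen v) = ⟨t.eval A v, t, rfl⟩ :=
    Subtype.ext ((A.subtype _ (A.isSubuniverse_range_eval v)).map_eval (A.gen v) t)
  apply Alg.Hom.ext
  funext x
  obtain ⟨_, t, rfl⟩ := x
  rw [← key, f.map_eval, f'.map_eval]
  exact congrArg (t.eval B) (funext h)

/-- The free algebra is generated by the generic element of the product of all algebras in `K` with
a distinguished element. To keep this product small, one algebra is chosen for each relation on
terms that arises as the kernel of an evaluation. -/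
theorem IsSPClass.exists_isFreeOn {K : ObjectProperty S.Alg} (hK : IsSPClass K) :
    ∃ (A : S.Alg) (g : A), K A ∧ IsFreeOn K A g := by
  let I : Type u := {r : Term S PUnit.{u + 1} → Term S PUnit.{u + 1} → Prop //
    ∃ (B : S.Alg) (v : PUnit → B), K B ∧ ∀ s t, r s t ↔ s.eval B v = t.eval B v}
  choose B v hB hr using fun i : I => i.2
  let w : PUnit.{u + 1} → Alg.prod B := fun j i => v i j
  refine ⟨(Alg.prod B).generated w, Alg.gen _ w ⟨⟩,
    hK.generated_mem (hK.prod_mem B hB) w, fun C hC c => ?_⟩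
  -- A relation between values of terms at `w` holds in every algebra of `K`.
  have key (s t : Term S PUnit.{u + 1}) (h : s.eval _ w = t.eval _ w) :
      s.eval C (fun _ => c) = t.eval C (fun _ => c) := by
    let i : I := ⟨fun s t => s.eval C (fun _ => c) = t.eval C (fun _ => c),
      C, fun _ => c, hC, fun _ _ => Iff.rfl⟩
    refine (hr i s t).2 ?_
    have := congrArg (Alg.proj B i).toFun h
    rwa [Alg.Hom.map_eval, Alg.Hom.map_eval] at this
  let f : Alg.Hom ((Alg.prod B).generated w) C :=
    { toFun := fun x => x.2.choose.eval C (fun _ => c)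
      map_op := fun o x => by
        have h := ((Alg.prod B).generated w).op o x |>.2.choose_spec
        refine key _ (.app o fun i => (x i).2.choose) (h.trans ?_)
        exact congrArg ((Alg.prod B).op o) (funext fun i => (x i).2.choose_spec.symm) }
  have hf : f.toFun (Alg.gen _ w ⟨⟩) = c :=
    key _ (.var ⟨⟩) (Alg.gen _ w ⟨⟩).2.choose_spec
  exact ⟨f, hf, fun f' hf' => Alg.generated_hom_ext fun _ => hf'.trans hf.symm⟩

end Signature

/-! ### The dualizing object -/

namespace CompactPospace

/-- The one-point compact pospace. -/
def point : CompactPospace.{u} where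
  carrier := PUnit
  closed := ⟨isClosed_discrete _⟩

/-- The map from the one-point compact pospace with a given value. -/
def ofPoint {X : CompactPospace.{u}} (x : X) : point ⟶ X :=
  (⟨⟨fun _ => x, fun _ _ _ => le_rfl⟩, continuous_const⟩ : point →Co X)

/-- The power of a compact pospace, with the product topology and the coordinatewise order. -/
def power (L : CompactPospace.{u}) (V : Type u) : CompactPospace.{u} := ⟨V → L⟩

/-- The coordinate projections of a power. -/
def powerProj (L : CompactPospace.{u}) {V : Type u} (i : V) : L.power V ⟶ L :=
  (⟨⟨fun x => x i, fun _ _ h => h i⟩, continuous_apply i⟩ : (V → L) →Co L)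

/-- The map to a power with given coordinates. -/
def powerLift {X L : CompactPospace.{u}} {V : Type u} (f : V → (X ⟶ L)) : X ⟶ L.power V :=
  let f' (i : V) : X →Co L := f i
  (⟨⟨fun x i => f' i x, fun _ _ h i => (f' i).monotone' h⟩,
    continuous_pi fun i => (f' i).continuous_toFun⟩ : X →Co (V → L))

theorem powerLift_proj {X L : CompactPospace.{u}} {V : Type u} (f : V → (X ⟶ L)) (i : V) :
    powerLift f ≫ powerProj L i = f i := rfl

theorem power_hom_ext {X L : CompactPospace.{u}} {V : Type u} {f f' : X ⟶ L.power V}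
    (h : ∀ i, f ≫ powerProj L i = f' ≫ powerProj L i) : f = f' := by
  refine DFunLike.ext (F := X →Co (V → L)) f f' fun x => funext fun i => ?_
  exact DFunLike.congr_fun (F := X →Co L) (h i) x

end CompactPospace

section Duality

open CompactPospace Signature

variable {S : Signature.{u}} {K : ObjectProperty S.Alg}

/-- The homomorphism corresponding to a morphism of compact pospaces. -/
def pullHom (F : CompactPospace.{u}ᵒᵖ ⥤ K.FullSubcategory) {X Y : CompactPospace.{u}}
    (f : X ⟶ Y) : Alg.Hom (F.obj (op Y)).obj (F.obj (op X)).obj :=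
  (F.map f.op).hom

variable (F : CompactPospace.{u}ᵒᵖ ⥤ K.FullSubcategory)

theorem pullHom_comp {X Y Z : CompactPospace.{u}} (f : X ⟶ Y) (g : Y ⟶ Z)
    (a : (F.obj (op Z)).obj) :
    (pullHom F (f ≫ g)).toFun a = (pullHom F f).toFun ((pullHom F g).toFun a) := by
  have : F.map (f ≫ g).op = F.map g.op ≫ F.map f.op := by rw [op_comp, F.map_comp]
  unfold pullHom
  rw [this]
  rfl

theorem pullHom_id {X : CompactPospace.{u}} (a : (F.obj (op X)).obj) :
    (pullHom F (𝟙 X)).toFun a = a := by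
  unfold pullHom
  rw [op_id, F.map_id]
  rfl

theorem pullHom_injective [F.Faithful] {X Y : CompactPospace.{u}} :
    Function.Injective (pullHom F : (X ⟶ Y) → _) := fun _ _ h =>
  Quiver.Hom.op_inj (F.map_injective (ObjectProperty.hom_ext _ h))

theorem pullHom_surjective [F.Full] {X Y : CompactPospace.{u}} :
    Function.Surjective (pullHom F : (X ⟶ Y) → _) := fun h => by
  obtain ⟨f, hf⟩ := F.map_surjective (ObjectProperty.homMk h : F.obj (op Y) ⟶ F.obj (op X))
  exact ⟨f.unop, congrArg (fun k => k.hom) hf⟩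

variable {F}

/-- Every algebra in `K` is isomorphic to one that corresponds to a compact pospace. -/
theorem exists_obj_inverse_homs [F.EssSurj] {A : S.Alg} (hA : K A) :
    ∃ (X : CompactPospace.{u}) (φ : Alg.Hom (F.obj (op X)).obj A)
      (ψ : Alg.Hom A (F.obj (op X)).obj),
      (∀ a, φ.toFun (ψ.toFun a) = a) ∧ ∀ a, ψ.toFun (φ.toFun a) = a := by
  let i := F.objObjPreimageIso ⟨A, hA⟩
  exact ⟨(F.objPreimage ⟨A, hA⟩).unop, i.hom.hom, i.inv.hom,
    fun a => congrArg (fun k : Alg.Hom A A => k.toFun a)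
      (congrArg (fun k => k.hom) i.inv_hom_id),
    fun a => congrArg (fun k : Alg.Hom (F.obj (F.objPreimage ⟨A, hA⟩)).obj _ => k.toFun a)
      (congrArg (fun k => k.hom) i.hom_inv_id)⟩

/-- Some compact pospace corresponds to a free algebra on one generator. -/
theorem exists_isFreeOn_obj [F.EssSurj] (hK : IsSPClass K) :
    ∃ (L : CompactPospace.{u}) (g : (F.obj (op L)).obj), IsFreeOn K (F.obj (op L)).obj g := by
  obtain ⟨A, g, hA, hg⟩ := hK.exists_isFreeOn
  obtain ⟨X, φ, ψ, hφψ, hψφ⟩ := exists_obj_inverse_homs (F := F) hA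
  refine ⟨X, ψ.toFun g, fun B hB b => ?_⟩
  obtain ⟨f, hf, hf'⟩ := hg B hB b
  refine ⟨(φ ≫ f : (F.obj (op X)).obj ⟶ B), ?_, fun k hk => ?_⟩
  · change f.toFun (φ.toFun (ψ.toFun g)) = b
    rw [hφψ, hf]
  · have := hf' (ψ ≫ k : A ⟶ B) hk
    apply Alg.Hom.ext
    funext x
    change k.toFun x = f.toFun (φ.toFun x)
    rw [← this]
    change _ = k.toFun (ψ.toFun (φ.toFun x))
    rw [hψφ]

section

variable {L : CompactPospace.{u}} {g : (F.obj (op L)).obj}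

theorem pullHom_generator_injective [F.Faithful] (hg : IsFreeOn K (F.obj (op L)).obj g)
    {X : CompactPospace.{u}} {x y : X ⟶ L}
    (h : (pullHom F x).toFun g = (pullHom F y).toFun g) : x = y :=
  pullHom_injective F ((hg _ (F.obj (op X)).property _).unique h rfl)

theorem pullHom_generator_surjective [F.Full] (hg : IsFreeOn K (F.obj (op L)).obj g)
    {X : CompactPospace.{u}} (a : (F.obj (op X)).obj) :
    ∃ x : X ⟶ L, (pullHom F x).toFun g = a := by
  obtain ⟨f, hf, -⟩ := hg _ (F.obj (op X)).property a
  obtain ⟨x, rfl⟩ := pullHom_surjective F f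
  exact ⟨x, hf⟩

/-- Points of a compact pospace are separated by the maps to an object that corresponds to a free
algebra. -/
theorem exists_hom_ne [F.Full] [F.Faithful] (hg : IsFreeOn K (F.obj (op L)).obj g)
    {X : CompactPospace.{u}} {x y : X} (hxy : x ≠ y) : ∃ f : X →Co L, f x ≠ f y := by
  by_contra! h
  have : ofPoint x = ofPoint y := by
    apply pullHom_injective F
    apply Alg.Hom.ext
    funext a
    obtain ⟨f, rfl⟩ := pullHom_generator_surjective hg a
    rw [← pullHom_comp, ← pullHom_comp]
    have : ofPoint x ≫ f = ofPoint y ≫ f :=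
      DFunLike.ext (F := point →Co L) _ _ fun _ => h f
    rw [this]
  exact hxy (DFunLike.congr_fun (F := point →Co X) this ⟨⟩)

/-- The algebra corresponding to a power of `L` is generated by the elements corresponding to the
projections. -/
theorem exists_eval_eq [F.IsEquivalence] (hK : IsSPClass K)
    (hg : IsFreeOn K (F.obj (op L)).obj g) {V : Type u} [Nonempty V]
    (a : (F.obj (op (L.power V))).obj) :
    ∃ t : Term S V, t.eval _ (fun i => (pullHom F (powerProj L i)).toFun g) = a := by
  let A : S.Alg := (F.obj (op (L.power V))).obj
  let p (i : V) : A := (pullHom F (powerProj L i)).toFun g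
  have hT : K (A.generated p) := hK.generated_mem (F.obj (op (L.power V))).property p
  let ι : Alg.Hom (A.generated p) A := A.subtype _ (A.isSubuniverse_range_eval p)
  -- A retraction of `A` onto the generated subalgebra, from the universal property of the power.
  obtain ⟨r, hr⟩ : ∃ r : Alg.Hom A (A.generated p), ∀ i, r.toFun (p i) = A.gen p i := by
    obtain ⟨X, φ, ψ, hφψ, -⟩ := exists_obj_inverse_homs (F := F) hT
    choose x hx using fun i : V => pullHom_generator_surjective hg
      (ψ.toFun (A.gen p i))
    let q : Alg.Hom A (F.obj (op X)).obj := pullHom F (powerLift x)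
    refine ⟨(q ≫ φ : A ⟶ A.generated p), fun i => ?_⟩
    change φ.toFun ((pullHom F (powerLift x)).toFun ((pullHom F (powerProj L i)).toFun g)) = _
    rw [← pullHom_comp, powerLift_proj, hx, hφψ]
  obtain ⟨x, hx⟩ := pullHom_surjective F (r ≫ ι : A ⟶ A)
  have hx_id : x = 𝟙 _ := by
    refine power_hom_ext fun i => pullHom_generator_injective hg ?_
    rw [pullHom_comp, Category.id_comp, hx]
    exact congrArg ι.toFun (hr i)
  have hιr : ι.toFun (r.toFun a) = a := by
    change Alg.Hom.toFun (r ≫ ι : A ⟶ A) a = a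
    rw [← hx, hx_id, pullHom_id]
  obtain ⟨t, ht⟩ := (r.toFun a).2
  exact ⟨t, ht.trans hιr⟩

/-- If the signature is finitary, continuous monotone maps from a power of `L` to `L` depend on only
finitely many coordinates. -/
theorem exists_finite_dependsOn [F.IsEquivalence] (hS : S.IsFinitary) (hK : IsSPClass K)
    (hg : IsFreeOn K (F.obj (op L)).obj g) {V : Type u} [Nonempty V] (f : (V → L) →Co L) :
    ∃ s : Set V, s.Finite ∧ DependsOn f s := by
  let f' : L.power V ⟶ L := f
  obtain ⟨t, ht⟩ := exists_eval_eq hK hg ((pullHom F f').toFun g)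
  obtain ⟨s, hs, hts⟩ := t.exists_finite_dependsOn hS
  refine ⟨s, hs, fun x y hxy => ?_⟩
  have key : ofPoint (X := L.power V) x ≫ f' = ofPoint (X := L.power V) y ≫ f' := by
    apply pullHom_generator_injective hg
    rw [pullHom_comp, pullHom_comp, ← ht, Alg.Hom.map_eval, Alg.Hom.map_eval]
    refine hts _ fun i hi => ?_
    rw [← pullHom_comp, ← pullHom_comp]
    have : ofPoint (X := L.power V) x ≫ powerProj L i =
        ofPoint (X := L.power V) y ≫ powerProj L i :=
      DFunLike.ext (F := point →Co L) _ _ fun _ => hxy i hi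
    rw [this]
  exact DFunLike.congr_fun (F := point →Co L) key ⟨⟩

end

end Duality

/-! ### A map depending on infinitely many coordinates -/

/-- The unit interval as a compact pospace. -/
def CompactPospace.unitInterval : CompactPospace.{u} where
  carrier := ULift.{u} (Icc (0 : ℝ) 1)
  order := PartialOrder.lift ULift.down ULift.down_injective
  closed :=
    { isClosed_le' := isClosed_le (α := Icc (0 : ℝ) 1) (continuous_uliftDown.comp continuous_fst)
        (continuous_uliftDown.comp continuous_snd) }

/-- A map from the unit interval that separates the end points can be reparametrized so that it
leaves its initial value immediately. -/
theorem exists_reparametrization {L : CompactPospace.{u}}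
    (f : CompactPospace.unitInterval.{u} →Co L)
    (hf : f ⟨⟨0, by simp⟩⟩ ≠ f ⟨⟨1, by simp⟩⟩) :
    ∃ h : ℝ → L, Continuous h ∧ Monotone h ∧ ∀ t, 0 < t → h t ≠ h 0 := by
  let k : ℝ → L := fun t => f ⟨projIcc 0 1 zero_le_one t⟩
  have hk : Continuous k :=
    f.continuous_toFun.comp (continuous_uliftUp.comp continuous_projIcc)
  have hkm : Monotone k := fun s t hst => f.monotone' (monotone_projIcc zero_le_one hst)
  let s := sSup {t | k t = k 0}
  have hne : {t | k t = k 0}.Nonempty := ⟨0, rfl⟩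
  have hbdd : BddAbove {t | k t = k 0} := by
    refine ⟨1, fun t ht => ?_⟩
    by_contra! h
    refine hf ?_
    have h1 : k t = f ⟨⟨1, by simp⟩⟩ := by
      simp only [k, projIcc_of_right_le zero_le_one h.le]
    have h0 : k 0 = f ⟨⟨0, by simp⟩⟩ := by
      simp only [k, projIcc_left]
    rw [← h0, ← h1]
    exact ht.symm
  have hs : k s = k 0 := (isClosed_eq hk continuous_const).csSup_mem hne hbdd
  refine ⟨fun t => k (s + t), by fun_prop, fun t t' h => hkm (by gcongr), fun t ht h => ?_⟩
  simp only [add_zero, hs] at h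
  linarith [le_csSup hbdd h]

/-- If a compact pospace admits a map from the unit interval separating the end points, then some
continuous monotone map on its countable power depends on all coordinates. -/
theorem exists_map_power_not_dependsOn {L : CompactPospace.{u}}
    (f : CompactPospace.unitInterval.{u} →Co L)
    (hf : f ⟨⟨0, by simp⟩⟩ ≠ f ⟨⟨1, by simp⟩⟩) :
    ∃ F : (ULift.{u} ℕ → L) →Co L, ∀ s : Set (ULift.{u} ℕ), DependsOn F s → s = Set.univ := by
  obtain ⟨h, hh, hhm, hh0⟩ := exists_reparametrization f hf
  have hab : ¬ h 1 ≤ h 0 := fun hle => hh0 1 one_pos (hle.antisymm (hhm zero_le_one))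
  obtain ⟨g, hg, hgm, hg0, hg1, hgI⟩ := exists_monotone_continuous_separating hab
  have hbound (x : ULift.{u} ℕ → L) (n : ℕ) : ‖(1 / 2) ^ n * g (x ⟨n⟩)‖ ≤ (1 / 2) ^ n := by
    rw [Real.norm_of_nonneg (mul_nonneg (by positivity) (hgI _).1)]
    exact mul_le_of_le_one_right (by positivity) (hgI _).2
  have hsum (x : ULift.{u} ℕ → L) : Summable fun n : ℕ => (1 / 2) ^ n * g (x ⟨n⟩) :=
    .of_norm_bounded summable_geometric_two (hbound x)
  refine ⟨⟨⟨fun x => h (∑' n : ℕ, (1 / 2) ^ n * g (x ⟨n⟩)), fun x y hxy => hhm ?_⟩, ?_⟩, ?_⟩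
  · refine (hsum x).tsum_le_tsum (fun n => ?_) (hsum y)
    gcongr
    exact hgm (hxy ⟨n⟩)
  · exact hh.comp (continuous_tsum (fun n => by fun_prop) summable_geometric_two
      fun n x => hbound x n)
  · intro s hs
    refine eq_univ_of_forall fun m => ?_
    by_contra hm
    classical
    -- Changing the coordinate `m` from `h 0` to `h 1` changes the sum from `0` to `2⁻¹ ^ m`.
    have key := hs (x := Function.update (fun _ => h 0) m (h 1)) (y := fun _ => h 0)
      fun i hi => Function.update_of_ne (by rintro rfl; exact hm hi) _ _
    refine hh0 ((1 / 2) ^ m.down) (by positivity) ?_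
    change h (∑' n : ℕ, _) = h (∑' n : ℕ, _) at key
    rw [tsum_eq_single m.down, Function.update_self] at key
    · simpa [hg0, hg1] using key
    · intro n hn
      rw [Function.update_of_ne (by rintro rfl; exact hn rfl), hg0, mul_zero]

/-! ### Non-equivalence -/

theorem Signature.IsSPClass.not_pospaceOpEquivTo {S : Signature.{u}} (hS : S.IsFinitary)
    {K : ObjectProperty S.Alg} (hK : IsSPClass K) : ¬ PospaceOpEquivTo K := by
  rintro ⟨e⟩
  obtain ⟨L, g, hg⟩ := exists_isFreeOn_obj (F := e.functor) hK
  obtain ⟨f, hf⟩ := exists_hom_ne hg (X := CompactPospace.unitInterval.{u})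
    (x := ⟨⟨0, by simp⟩⟩) (y := ⟨⟨1, by simp⟩⟩)
    fun h => zero_ne_one (congrArg (fun t : ULift (Icc (0 : ℝ) 1) => (t.down : ℝ)) h)
  obtain ⟨G, hG⟩ := exists_map_power_not_dependsOn f hf
  obtain ⟨s, hs, hGs⟩ := exists_finite_dependsOn hS hK hg G
  exact infinite_univ (α := ULift.{u} ℕ) (hG s hGs ▸ hs)

theorem mainTheorem3 :
    (∀ (S : Signature.{u}), S.IsFinitary →
      ∀ K : ObjectProperty S.Alg, Signature.IsSPClass K → ¬ PospaceOpEquivTo K) ∧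
    (∀ (S : Signature.{u}), S.IsFinitary →
      ∀ K : ObjectProperty S.Alg, Signature.IsVariety K → ¬ PospaceOpEquivTo K) ∧
    (∀ (S : Signature.{u}), S.IsFinitary →
      ∀ K : ObjectProperty S.Alg, Signature.IsQuasiVariety ℵ₀ K → ¬ PospaceOpEquivTo K) ∧
    (∀ (κ : Cardinal.{u}) (S : Signature.{u}), S.IsAry κ →
      ∀ K : ObjectProperty S.Alg, (Signature.IsVariety K ∨ Signature.IsQuasiVariety κ K) →
        PospaceOpEquivTo K → ℵ₁ ≤ κ) := by
  refine ⟨fun S hS K hK => hK.not_pospaceOpEquivTo hS,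
    fun S hS K hK => hK.isQuasiVariety.isSPClass.not_pospaceOpEquivTo hS,
    fun S hS K hK => hK.isSPClass.not_pospaceOpEquivTo hS, fun κ S hS K hK hE => ?_⟩
  by_contra! hκ
  have hκ' : κ ≤ ℵ₀ := by rwa [← succ_aleph0, Order.lt_succ_iff] at hκ
  have hfin : S.IsFinitary := fun o => lt_aleph0_iff_finite.1 ((hS o).trans_le hκ')
  have hSP : Signature.IsSPClass K := hK.elim (fun h => h.isQuasiVariety.isSPClass)
    fun h => h.isSPClass
  exact hSP.not_pospaceOpEquivTo hfin hE
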